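/- Work in the universe of sets. For a transitive class $M$ (a set or a proper class) with $(M,\in)\models\mathsf{ZF}$, let $\mathrm{Ord}^M$ be the class of ordinals belonging to $M$, and define, by recursion on the ordinal $\alpha$, the iterated power classes of a class $A\subseteq M$ as computed in $M$: $$\mathcal P^0(A)^M=A,\qquad \mathcal P^{\alpha+1}(A)^M=\{x\in M: x\subseteq \mathcal P^\alpha(A)^M\},\qquad \mathcal P^\alpha(A)^M=\bigcup_{\beta<\alpha}\mathcal P^\beta(A)^M\ \text{ for limit }\alpha .$$ For an ordinal $\alpha\in M$, say that $M\models\mathsf{KWP}^*_\alpha$ if for every $x\in M$ there are an ordinal $\eta\in M$ and a partial function $f\in M$ from $\mathcal P^\alpha(\eta)^M$ onto $x$. **Theorem (Balcar–Vopěnka–Monro).** Let $M$ and $N$ be transitive classes that are models of $\mathsf{ZF}$ and let $\alpha$ be an ordinal of $M$. If $\mathcal P^{\alpha+1}(\mathrm{Ord}^M)^M=\mathcal P^{\alpha+1}(\mathrm{Ord}^N)^N$ and $M\models\mathsf{KWP}^*_\alpha$, then $M=N$. -/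

import Mathlib

universe u

namespace KinnaWagner

/-- The only symbol of the first-order language of set theory: a binary relation. -/
inductive SetRel : ℕ → Type
  | mem : SetRel 2

/-- The first-order language of set theory. -/
def setLanguage : FirstOrder.Language.{0, 0} := ⟨fun _ => Empty, SetRel⟩

/-- A class `M` of sets is a structure `(M, ∈)` for the language of set theory. -/
instance setStructure (M : Set ZFSet.{u}) : setLanguage.Structure M where
  funMap := fun f _ => Empty.elim f
  RelMap := fun r => match r with
    | .mem => fun v => (v 0).1 ∈ (v 1).1

/-- A class is transitive if it contains all members of its members. -/
def TransitiveClass (M : Set ZFSet.{u}) : Prop :=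
  ∀ x ∈ M, ∀ y ∈ x, y ∈ M

/-- `(M, ∈) ⊨ ZF`: all quantifiers range over `M`, and the two schemas run over all first-order
formulas of the language of set theory with parameters from `M`. -/
structure ModelsZF (M : Set ZFSet.{u}) : Prop where
  extensionality : ∀ x y : M, (∀ z : M, z.1 ∈ x.1 ↔ z.1 ∈ y.1) → x = y
  foundation : ∀ x : M, (∃ y : M, y.1 ∈ x.1) →
    ∃ y : M, y.1 ∈ x.1 ∧ ∀ z : M, z.1 ∈ x.1 → z.1 ∉ y.1
  pairing : ∀ x y : M, ∃ z : M, ∀ w : M, w.1 ∈ z.1 ↔ w = x ∨ w = y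
  union : ∀ x : M, ∃ z : M, ∀ w : M, w.1 ∈ z.1 ↔ ∃ y : M, y.1 ∈ x.1 ∧ w.1 ∈ y.1
  powerset : ∀ x : M, ∃ p : M, ∀ z : M, z.1 ∈ p.1 ↔ ∀ w : M, w.1 ∈ z.1 → w.1 ∈ x.1
  infinity : ∃ x : M, (∃ e : M, (∀ z : M, z.1 ∉ e.1) ∧ e.1 ∈ x.1) ∧
    ∀ y : M, y.1 ∈ x.1 → ∃ s : M, (∀ z : M, z.1 ∈ s.1 ↔ z.1 ∈ y.1 ∨ z = y) ∧ s.1 ∈ x.1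
  separation : ∀ D : Set M, (Set.univ : Set M).Definable₁ setLanguage D →
    ∀ a : M, ∃ b : M, ∀ x : M, x.1 ∈ b.1 ↔ x.1 ∈ a.1 ∧ x ∈ D
  replacement : ∀ R : Set (M × M), (Set.univ : Set M).Definable₂ setLanguage R →
    ∀ a : M, (∀ x : M, x.1 ∈ a.1 → ∃! y : M, (x, y) ∈ R) →
      ∃ b : M, ∀ y : M, y.1 ∈ b.1 ↔ ∃ x : M, x.1 ∈ a.1 ∧ (x, y) ∈ R

/-- The ordinals of `M`. For transitive `M` this is `Ord` as computed in `M`. -/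
def ordinalsOf (M : Set ZFSet.{u}) : Set ZFSet.{u} :=
  {x | x ∈ M ∧ x.IsOrdinal}

/-- The power class of `A` as computed in `M`: the sets in `M` that are included in `A`. -/
def relPowerset (M A : Set ZFSet.{u}) : Set ZFSet.{u} :=
  {x | x ∈ M ∧ ∀ y ∈ x, y ∈ A}

/-- The iterated power class `P^α(A)` as computed in `M`: `P^0(A) = A`, `P^(α+1)(A)` is the power
class of `P^α(A)`, and at limits unions are taken. The starting class `A` may be a set of `M` or
a proper class such as the ordinals of `M`. -/
noncomputable def relIterPower (M A : Set ZFSet.{u}) (α : Ordinal.{u}) : Set ZFSet.{u} :=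
  Ordinal.limitRecOn α A (fun _ P => relPowerset M P)
    (fun α _ P => {x | ∃ (β : Ordinal.{u}) (h : β < α), x ∈ P β h})

theorem relIterPower_zero (M A : Set ZFSet.{u}) : relIterPower M A 0 = A := by
  simp [relIterPower]

theorem relIterPower_add_one (M A : Set ZFSet.{u}) (α : Ordinal.{u}) :
    relIterPower M A (α + 1) = relPowerset M (relIterPower M A α) := by
  simp [relIterPower]

theorem relIterPower_limit (M A : Set ZFSet.{u}) (α : Ordinal.{u}) (h : Order.IsSuccLimit α) :
    relIterPower M A α = {x | ∃ β < α, x ∈ relIterPower M A β} := by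
  unfold relIterPower
  rw [Ordinal.limitRecOn_limit _ _ _ _ h]
  simp only [exists_prop]

/-- `f` is (the graph of) a partial function from the class `A` onto the set `x`. -/
def IsPartialSurjection (f : ZFSet.{u}) (A : Set ZFSet.{u}) (x : ZFSet.{u}) : Prop :=
  (∀ p ∈ f, ∃ a ∈ A, ∃ b ∈ x, p = ZFSet.pair a b) ∧
  (∀ a b c, ZFSet.pair a b ∈ f → ZFSet.pair a c ∈ f → b = c) ∧
  (∀ b ∈ x, ∃ a, ZFSet.pair a b ∈ f)

/-- `M ⊨ KWP*_α`: in `M`, for every set `x` there are an ordinal `η` and a partial function from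
`P^α(η)` onto `x`. -/
def ModelsKWPStar (M : Set ZFSet.{u}) (α : Ordinal.{u}) : Prop :=
  ∀ x ∈ M, ∃ η : Ordinal.{u}, η.toZFSet ∈ M ∧
    ∃ f ∈ M, IsPartialSurjection f (relIterPower M {y | y ∈ η.toZFSet} α) x

end KinnaWagner

namespace KinnaWagner

open FirstOrder FirstOrder.Language

/-! A surjection from a set of elements of `P^α(Ord)^M` lets subsets of `P^α(Ord)^M` stand for
arbitrary sets.

For `M ⊆ N`, let `x ∈ M` lie in a transitive `t ∈ M`, and let `f ∈ M` map `D ⊆ P^α(Ord)^M` onto `t`.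
The relation `f a ∈ f b` on `D` is a set of pairs. Pairs of elements of `D` are coded injectively by
elements of `P^α(Ord)^M`, by a code in `M ∩ N` (`exists_pairingCode`), so this relation is coded by
an element of `P^(α+1)(Ord)^M` and belongs to `N`. As `t` is transitive, `f` is the Mostowski
collapse of the relation, and `N` recovers `f`, hence `x`, by well-founded recursion
(`graphOn_mem_of_recursion`).

For `N ⊆ M`, use ∈-induction on `y ∈ N`. By induction `y` is a subset of `V_(rank y) ∩ M`, a set of
`M` (`sep_vonNeumann_mem`). If `f ∈ M` maps `D` onto that set, the preimage of `y` lies in `N` and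
consists of elements of `P^α(Ord)`, so the hypothesis on `P^(α+1)` puts it in `M`, and `y` is its
image under `f`.

Separation and Replacement are applied through a calculus of predicates and terms closed under
logical operations (`DefPred`, `DefTerm`), with the innermost variable at index `0`. -/

/-- Prepend a value to an assignment of the variables. -/
def scons {A : Type*} (x : A) (v : ℕ → A) : ℕ → A
  | 0 => x
  | i + 1 => v i

/-- Drop the value of the variable `0`. -/
def stail {A : Type*} (v : ℕ → A) : ℕ → A := fun i => v (i + 1)

@[simp] theorem stail_scons {A : Type*} (x : A) (v : ℕ → A) : stail (scons x v) = v := rfl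

@[simp] theorem scons_zero {A : Type*} (x : A) (v : ℕ → A) : scons x v 0 = x := rfl

/-- A predicate of assignments in `K` that is first-order definable over `(K, ∈)` with
parameters. -/
def DefPred (K : Set ZFSet.{u}) (P : (ℕ → K) → Prop) : Prop :=
  (Set.univ : Set K).Definable setLanguage {v | P v}

/-- A function from assignments in `K` to `K` whose graph is definable over `(K, ∈)`. -/
def DefTerm (K : Set ZFSet.{u}) (t : (ℕ → K) → ZFSet.{u}) : Prop :=
  (∀ v, t v ∈ K) ∧ DefPred K (fun w => (w 0).1 = t (stail w))

/-! ### Definability with parameters over `(K, ∈)`. -/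

section Logic

variable {K : Set ZFSet.{u}}

theorem defPred_iff {P : (ℕ → K) → Prop} :
    DefPred K P ↔ ∃ φ : (setLanguage[[(Set.univ : Set K)]]).Formula ℕ, ∀ v, φ.Realize v ↔ P v := by
  refine exists_congr fun φ => ?_
  rw [Set.ext_iff]
  exact forall_congr' fun v => Iff.comm

theorem DefPred.congr {P Q : (ℕ → K) → Prop} (h : DefPred K P) (e : ∀ v, Q v ↔ P v) :
    DefPred K Q := by
  obtain rfl : Q = P := funext fun v => propext (e v)
  exact h

theorem DefPred.not {P : (ℕ → K) → Prop} (h : DefPred K P) : DefPred K (fun v => ¬ P v) :=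
  Set.Definable.compl h

theorem DefPred.and {P Q : (ℕ → K) → Prop} (h : DefPred K P) (h' : DefPred K Q) :
    DefPred K (fun v => P v ∧ Q v) :=
  Set.Definable.inter h h'

theorem DefPred.or {P Q : (ℕ → K) → Prop} (h : DefPred K P) (h' : DefPred K Q) :
    DefPred K (fun v => P v ∨ Q v) :=
  Set.Definable.union h h'

theorem DefPred.imp {P Q : (ℕ → K) → Prop} (h : DefPred K P) (h' : DefPred K Q) :
    DefPred K (fun v => P v → Q v) :=
  (h.not.or h').congr fun _ => imp_iff_not_or

theorem DefPred.iff {P Q : (ℕ → K) → Prop} (h : DefPred K P) (h' : DefPred K Q) :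
    DefPred K (fun v => P v ↔ Q v) :=
  ((h.imp h').and (h'.imp h)).congr fun _ => iff_def

theorem DefPred.rename {P : (ℕ → K) → Prop} (h : DefPred K P) (s : ℕ → ℕ) :
    DefPred K (fun v => P (fun i => v (s i))) :=
  Set.Definable.preimage_comp s h

theorem DefPred.exists_var {P : (ℕ → K) → K → Prop}
    (h : DefPred K (fun w => P (stail w) (w 0))) : DefPred K (fun v => ∃ x, P v x) := by
  obtain ⟨φ, hφ⟩ := defPred_iff.1 h
  -- Variable `0` becomes the bound variable; variable `i + 1` becomes the free variable `i`.
  let g : ℕ → ℕ ⊕ Fin 1 := fun i => Nat.casesOn i (Sum.inr 0) Sum.inl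
  refine defPred_iff.2 ⟨(BoundedFormula.relabel (n := 1) (k := 0) g φ).ex, fun v => ?_⟩
  rw [Formula.Realize, BoundedFormula.realize_ex]
  refine exists_congr fun a => ?_
  rw [BoundedFormula.realize_relabel]
  have : (Sum.elim v ((Fin.snoc default a : Fin 1 → K) ∘ Fin.castAdd 0)) ∘ g = scons a v := by
    funext i
    cases i <;> rfl
  rw [this]
  have := hφ (scons a v)
  rw [Formula.Realize] at this
  simp only [stail_scons, scons_zero] at this
  rw [← this]
  exact iff_of_eq (congrArg _ (Subsingleton.elim _ _))

theorem DefPred.exists_mem_class {P : (ℕ → K) → ZFSet.{u} → Prop}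
    (h : DefPred K (fun w => P (stail w) (w 0))) : DefPred K (fun v => ∃ x ∈ K, P v x) :=
  (DefPred.exists_var (P := fun v x => P v x) h).congr fun v => by simp

theorem DefPred.forall_mem_class {P : (ℕ → K) → ZFSet.{u} → Prop}
    (h : DefPred K (fun w => P (stail w) (w 0))) : DefPred K (fun v => ∀ x ∈ K, P v x) :=
  (DefPred.exists_mem_class (P := fun v x => ¬ P v x) h.not).not.congr fun v => by
    push Not; rfl

theorem defPred_eq_var (i j : ℕ) : DefPred K (fun v => (v i).1 = (v j).1) :=
  defPred_iff.2 ⟨(Term.var i).equal (Term.var j), fun v => by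
    simp [Formula.realize_equal, Subtype.ext_iff]⟩

theorem defPred_mem_var (i j : ℕ) : DefPred K (fun v => (v i).1 ∈ (v j).1) :=
  defPred_iff.2 ⟨(show (setLanguage[[(Set.univ : Set K)]]).Relations 2 from
    Sum.inl SetRel.mem).formula₂ (Term.var i) (Term.var j), fun v => by
    rw [Formula.realize_rel₂]
    rfl⟩

/-- The bridge to the schemas of `ModelsZF`, whose definable sets have one or two free variables:
`s` says which variables stay free and which are replaced by constants. -/
theorem DefPred.fix {P : (ℕ → K) → Prop} (h : DefPred K P) {n : ℕ} (s : ℕ → Fin n ⊕ K) :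
    (Set.univ : Set K).Definable setLanguage
      {x : Fin n → K | P (fun i => Sum.elim x id (s i))} := by
  obtain ⟨φ, hφ⟩ := defPred_iff.1 h
  refine ⟨φ.subst fun i => Sum.elim Term.var
    (fun c => (setLanguage.con (⟨c, trivial⟩ : (Set.univ : Set K))).term) (s i), ?_⟩
  ext x
  have := hφ (fun i => Sum.elim x id (s i))
  rw [Set.mem_ofPred_eq, ← this]
  simp only [Set.mem_ofPred_eq]
  rw [Formula.Realize, Formula.Realize, BoundedFormula.realize_subst]
  refine iff_of_eq (congrArg (fun f => BoundedFormula.Realize φ f _) (funext fun i => ?_))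
  cases s i <;> rfl

theorem DefTerm.var (i : ℕ) : DefTerm K (fun v => (v i).1) :=
  ⟨fun v => (v i).2, defPred_eq_var 0 (i + 1)⟩

theorem DefTerm.rename {t : (ℕ → K) → ZFSet.{u}} (h : DefTerm K t) (s : ℕ → ℕ) :
    DefTerm K (fun v => t (fun i => v (s i))) :=
  ⟨fun _ => h.1 _, h.2.rename fun i => Nat.casesOn i 0 fun j => s j + 1⟩

theorem DefTerm.tail {t : (ℕ → K) → ZFSet.{u}} (h : DefTerm K t) :
    DefTerm K (fun v => t (stail v)) :=
  h.rename _

theorem DefPred.tail {P : (ℕ → K) → Prop} (h : DefPred K P) :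
    DefPred K (fun v => P (stail v)) :=
  h.rename _

theorem DefTerm.const {c : ZFSet.{u}} (hc : c ∈ K) : DefTerm K (fun _ => c) :=
  ⟨fun _ => hc, defPred_iff.2
    ⟨(Term.var 0).equal (setLanguage.con (⟨⟨c, hc⟩, trivial⟩ : (Set.univ : Set K))).term,
      fun v => by
        rw [Formula.realize_equal, Term.realize_con]
        simp [Subtype.ext_iff]⟩⟩

/-- Substitution of a definable term for the variable `0`. -/
theorem DefPred.subst {P : (ℕ → K) → ZFSet.{u} → Prop} {t : (ℕ → K) → ZFSet.{u}}
    (h : DefPred K (fun w => P (stail w) (w 0))) (ht : DefTerm K t) :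
    DefPred K (fun v => P v (t v)) :=
  (DefPred.exists_mem_class (P := fun v x => x = t v ∧ P v x) (ht.2.and h)).congr fun v =>
    ⟨fun hv => ⟨_, ht.1 v, rfl, hv⟩, by rintro ⟨_, _, rfl, hv⟩; exact hv⟩

theorem DefPred.mem {s t : (ℕ → K) → ZFSet.{u}} (hs : DefTerm K s) (ht : DefTerm K t) :
    DefPred K (fun v => s v ∈ t v) :=
  DefPred.subst (P := fun v y => s v ∈ y)
    (DefPred.subst (P := fun v y => y ∈ (v 0).1) (defPred_mem_var 0 1) hs.tail) ht

theorem DefPred.eq {s t : (ℕ → K) → ZFSet.{u}} (hs : DefTerm K s) (ht : DefTerm K t) :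
    DefPred K (fun v => s v = t v) :=
  DefPred.subst (P := fun v y => s v = y)
    (DefPred.subst (P := fun v y => y = (v 0).1) (defPred_eq_var 0 1) hs.tail) ht

/-- Substitution of a definable term for the variable `0`. -/
theorem DefTerm.subst {F : (ℕ → K) → ZFSet.{u} → ZFSet.{u}} {t : (ℕ → K) → ZFSet.{u}}
    (h : DefTerm K (fun w => F (stail w) (w 0))) (ht : DefTerm K t) :
    DefTerm K (fun v => F v (t v)) :=
  ⟨fun v => h.1 (scons ⟨t v, ht.1 v⟩ v),
    DefPred.subst (P := fun w y => (w 0).1 = F (stail w) y)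
      -- In the graph of `F` the value has index `0` and the argument index `1`; `DefPred.subst`
      -- needs the argument at `0`.
      (h.2.rename fun | 0 => 1 | 1 => 0 | k + 2 => k + 2 :) ht.tail⟩

theorem DefPred.exists_mem (hK : TransitiveClass K) {P : (ℕ → K) → ZFSet.{u} → Prop}
    {t : (ℕ → K) → ZFSet.{u}} (ht : DefTerm K t) (h : DefPred K (fun w => P (stail w) (w 0))) :
    DefPred K (fun v => ∃ x ∈ t v, P v x) :=
  (DefPred.exists_mem_class (P := fun v x => x ∈ t v ∧ P v x)
    ((DefPred.mem (.var 0) ht.tail).and h)).congr fun v =>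
    ⟨fun ⟨x, hx, hP⟩ => ⟨x, hK _ (ht.1 v) _ hx, hx, hP⟩, fun ⟨x, _, hx, hP⟩ => ⟨x, hx, hP⟩⟩

theorem DefPred.forall_mem (hK : TransitiveClass K) {P : (ℕ → K) → ZFSet.{u} → Prop}
    {t : (ℕ → K) → ZFSet.{u}} (ht : DefTerm K t) (h : DefPred K (fun w => P (stail w) (w 0))) :
    DefPred K (fun v => ∀ x ∈ t v, P v x) :=
  (DefPred.exists_mem hK (P := fun v x => ¬ P v x) ht h.not).not.congr fun v => by
    push Not; rfl

theorem DefPred.subset (hK : TransitiveClass K) {s t : (ℕ → K) → ZFSet.{u}} (hs : DefTerm K s)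
    (ht : DefTerm K t) : DefPred K (fun v => s v ⊆ t v) :=
  (DefPred.forall_mem hK hs (P := fun v x => x ∈ t v) (.mem (.var 0) ht.tail)).congr fun _ =>
    Iff.rfl

/-- A function into `K` is definable as soon as membership in its values is. -/
theorem DefTerm.of_mem (hK : TransitiveClass K) {t : (ℕ → K) → ZFSet.{u}}
    {P : (ℕ → K) → ZFSet.{u} → Prop} (ht : ∀ v, t v ∈ K)
    (hP : DefPred K (fun w => P (stail w) (w 0)))
    (h : ∀ v, ∀ x ∈ K, x ∈ t v ↔ P v x) : DefTerm K t := by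
  refine ⟨ht, (DefPred.forall_mem_class (P := fun w x => x ∈ (w 0).1 ↔ P (stail w) x)
    (.iff (.mem (.var 0) (.var 1))
      (hP.rename fun | 0 => 0 | j + 1 => j + 2 :))).congr fun w => ?_⟩
  constructor
  · intro e x hx
    rw [e, h _ x hx]
  · intro e
    ext x
    constructor
    · intro hx
      have hxK := hK _ (w 0).2 _ hx
      exact (h _ x hxK).2 ((e x hxK).1 hx)
    · intro hx
      have hxK := hK _ (ht _) _ hx
      exact (e x hxK).2 ((h _ x hxK).1 hx)

end Logic

/-! ### Images and functions coded as sets of pairs. -/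

/-- The image `{f y | y ∈ a}` of a set. -/
noncomputable def img (f : ZFSet.{u} → ZFSet.{u}) (a : ZFSet.{u}) : ZFSet.{u} :=
  ZFSet.range fun x : {x // x ∈ a} => f x.1

@[simp] theorem mem_img {f : ZFSet.{u} → ZFSet.{u}} {a y : ZFSet.{u}} :
    y ∈ img f a ↔ ∃ x ∈ a, f x = y := by
  simp [img]

theorem img_congr {f g : ZFSet.{u} → ZFSet.{u}} {a : ZFSet.{u}} (h : ∀ x ∈ a, f x = g x) :
    img f a = img g a := by
  ext y
  simp only [mem_img]
  exact exists_congr fun x => and_congr_right fun hx => by rw [h x hx]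

theorem img_insert {f : ZFSet.{u} → ZFSet.{u}} {a b : ZFSet.{u}} :
    img f (insert a b) = insert (f a) (img f b) := by
  ext y
  simp only [mem_img, ZFSet.mem_insert_iff, or_and_right, exists_or, exists_eq_left,
    eq_comm (a := y)]

/-- The value at `a` of a function coded as a set of pairs. -/
def app (f a : ZFSet.{u}) : ZFSet.{u} :=
  ZFSet.sUnion (ZFSet.sep (fun b => ZFSet.pair a b ∈ f) (ZFSet.sUnion (ZFSet.sUnion f)))

/-- The graph of `f` on the set `a`. -/
noncomputable def graphOn (f : ZFSet.{u} → ZFSet.{u}) (a : ZFSet.{u}) : ZFSet.{u} :=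
  img (fun x => ZFSet.pair x (f x)) a

theorem mem_sUnion_sUnion_of_pair {f a b : ZFSet.{u}} (h : ZFSet.pair a b ∈ f) :
    a ∈ ZFSet.sUnion (ZFSet.sUnion f) ∧ b ∈ ZFSet.sUnion (ZFSet.sUnion f) := by
  simp only [ZFSet.mem_sUnion]
  refine ⟨⟨{a, b}, ⟨_, h, ?_⟩, ?_⟩, ⟨{a, b}, ⟨_, h, ?_⟩, ?_⟩⟩ <;> simp [ZFSet.pair]

/-- `app f a` is the union of all values at `a`, so it is the value when there is exactly one and
`∅` when there is none. -/
theorem app_eq {f a b : ZFSet.{u}} (h : ZFSet.pair a b ∈ f)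
    (hu : ∀ c, ZFSet.pair a c ∈ f → c = b) : app f a = b := by
  ext x
  simp only [app, ZFSet.mem_sUnion (x := ZFSet.sep _ _), ZFSet.mem_sep]
  constructor
  · rintro ⟨c, ⟨_, hc⟩, hx⟩
    rwa [← hu c hc]
  · intro hx
    exact ⟨b, ⟨(mem_sUnion_sUnion_of_pair h).2, h⟩, hx⟩

theorem pair_mem_graphOn {f : ZFSet.{u} → ZFSet.{u}} {a x y : ZFSet.{u}} :
    ZFSet.pair x y ∈ graphOn f a ↔ x ∈ a ∧ y = f x := by
  simp only [graphOn, mem_img, ZFSet.pair_inj]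
  constructor
  · rintro ⟨z, hz, rfl, rfl⟩
    exact ⟨hz, rfl⟩
  · rintro ⟨hx, rfl⟩
    exact ⟨x, hx, rfl, rfl⟩

theorem app_graphOn {f : ZFSet.{u} → ZFSet.{u}} {a x : ZFSet.{u}} (h : x ∈ a) :
    app (graphOn f a) x = f x :=
  app_eq (pair_mem_graphOn.2 ⟨h, rfl⟩) fun _ hc => (pair_mem_graphOn.1 hc).2

/-- A transitive class that is a model of `ZF`. -/
structure TransModel (K : Set ZFSet.{u}) : Prop where
  trans : TransitiveClass K
  zf : ModelsZF K

/-! ### Closure of transitive models under set operations. -/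

namespace TransModel

variable {K : Set ZFSet.{u}} (hK : TransModel K)
include hK

theorem upair_mem {x y : ZFSet.{u}} (hx : x ∈ K) (hy : y ∈ K) : ({x, y} : ZFSet.{u}) ∈ K := by
  obtain ⟨z, hz⟩ := hK.zf.pairing ⟨x, hx⟩ ⟨y, hy⟩
  convert z.2
  ext w
  rw [ZFSet.mem_pair]
  constructor
  · rintro (rfl | rfl)
    · exact (hz ⟨_, hx⟩).2 (.inl rfl)
    · exact (hz ⟨_, hy⟩).2 (.inr rfl)
  · intro hw
    simpa [Subtype.ext_iff] using (hz ⟨w, hK.trans _ z.2 _ hw⟩).1 hw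

theorem sUnion_mem {x : ZFSet.{u}} (hx : x ∈ K) : ZFSet.sUnion x ∈ K := by
  obtain ⟨z, hz⟩ := hK.zf.union ⟨x, hx⟩
  convert z.2
  ext w
  rw [ZFSet.mem_sUnion]
  constructor
  · rintro ⟨y, hy, hw⟩
    have hyK := hK.trans _ hx _ hy
    exact (hz ⟨w, hK.trans _ hyK _ hw⟩).2 ⟨⟨y, hyK⟩, hy, hw⟩
  · intro hw
    obtain ⟨y, hy, hwy⟩ := (hz ⟨w, hK.trans _ z.2 _ hw⟩).1 hw
    exact ⟨y.1, hy, hwy⟩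

theorem relPowerset_mem {x : ZFSet.{u}} (hx : x ∈ K) :
    ZFSet.sep (· ∈ K) (ZFSet.powerset x) ∈ K := by
  obtain ⟨p, hp⟩ := hK.zf.powerset ⟨x, hx⟩
  convert p.2
  ext w
  rw [ZFSet.mem_sep, ZFSet.mem_powerset]
  constructor
  · rintro ⟨hw, hwK⟩
    exact (hp ⟨w, hwK⟩).2 fun v hv => hw hv
  · intro hw
    have hwK := hK.trans _ p.2 _ hw
    exact ⟨fun v hv => (hp ⟨w, hwK⟩).1 hw ⟨v, hK.trans _ hwK _ hv⟩ hv, hwK⟩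

theorem sep_mem {P : (ℕ → K) → ZFSet.{u} → Prop} (hP : DefPred K (fun w => P (stail w) (w 0)))
    (v : ℕ → K) {a : ZFSet.{u}} (ha : a ∈ K) : ZFSet.sep (P v) a ∈ K := by
  have h := hP.fix (n := 1) fun | 0 => .inl 0 | i + 1 => .inr (v i)
  obtain ⟨b, hb⟩ := hK.zf.separation {x | P v x} h ⟨a, ha⟩
  convert b.2
  ext x
  rw [ZFSet.mem_sep]
  constructor
  · intro hx
    exact (hb ⟨x, hK.trans _ ha _ hx.1⟩).2 hx
  · intro hx
    exact (hb ⟨x, hK.trans _ b.2 _ hx⟩).1 hx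

theorem img_mem {F : (ℕ → K) → ZFSet.{u} → ZFSet.{u}}
    (hF : DefTerm K (fun w => F (stail w) (w 0)))
    (v : ℕ → K) {a : ZFSet.{u}} (ha : a ∈ K) : img (F v) a ∈ K := by
  -- The graph lists the value first, Replacement the argument first, hence the swap.
  have h := hF.2.fix (n := 2) fun | 0 => .inl 1 | 1 => .inl 0 | i + 2 => .inr (v i)
  have hFK : ∀ x ∈ K, F v x ∈ K := fun x hx => hF.1 (scons ⟨x, hx⟩ v)
  obtain ⟨b, hb⟩ := hK.zf.replacement {p | p.2.1 = F v p.1} h ⟨a, ha⟩ fun x _ =>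
    ⟨⟨F v x, hFK _ x.2⟩, rfl, fun y hy => Subtype.ext hy⟩
  convert b.2
  ext y
  rw [mem_img]
  constructor
  · rintro ⟨x, hx, rfl⟩
    have hxK := hK.trans _ ha _ hx
    exact (hb ⟨_, hFK _ hxK⟩).2 ⟨⟨x, hxK⟩, hx, rfl⟩
  · intro hy
    obtain ⟨x, hx, hxy⟩ := (hb ⟨y, hK.trans _ b.2 _ hy⟩).1 hy
    exact ⟨x, hx, hxy.symm⟩

theorem empty_mem : (∅ : ZFSet.{u}) ∈ K := by
  obtain ⟨_, ⟨e, he, _⟩, _⟩ := hK.zf.infinity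
  convert e.2
  ext z
  exact iff_of_false (ZFSet.notMem_empty z) fun hz => he ⟨z, hK.trans _ e.2 _ hz⟩ hz

/-- The assignment of the empty set to all variables. -/
def zeroAssignment : ℕ → K := fun _ => ⟨∅, hK.empty_mem⟩

end TransModel

/-! ### Definable set operations. -/

section Terms

variable {K : Set ZFSet.{u}} {s t : (ℕ → K) → ZFSet.{u}}

theorem DefTerm.upair (hK : TransModel K) (hs : DefTerm K s) (ht : DefTerm K t) :
    DefTerm K (fun v => {s v, t v}) :=
  .of_mem hK.trans (P := fun v x => x = s v ∨ x = t v) (fun v => hK.upair_mem (hs.1 v) (ht.1 v))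
    (.or (.eq (.var 0) hs.tail) (.eq (.var 0) ht.tail)) fun _ _ _ => ZFSet.mem_pair

theorem DefTerm.singleton (hK : TransModel K) (hs : DefTerm K s) :
    DefTerm K (fun v => {s v}) := by
  convert DefTerm.upair hK hs hs using 2
  ext
  simp

theorem DefTerm.pair (hK : TransModel K) (hs : DefTerm K s) (ht : DefTerm K t) :
    DefTerm K (fun v => ZFSet.pair (s v) (t v)) :=
  .upair hK (.singleton hK hs) (.upair hK hs ht)

theorem DefTerm.sUnion (hK : TransModel K) (hs : DefTerm K s) :
    DefTerm K (fun v => ZFSet.sUnion (s v)) :=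
  .of_mem hK.trans (P := fun v x => ∃ y ∈ s v, x ∈ y) (fun v => hK.sUnion_mem (hs.1 v))
    (.exists_mem hK.trans hs.tail (P := fun w y => (w 0).1 ∈ y) (.mem (.var 1) (.var 0)))
    fun _ _ _ => ZFSet.mem_sUnion

theorem DefTerm.union (hK : TransModel K) (hs : DefTerm K s) (ht : DefTerm K t) :
    DefTerm K (fun v => s v ∪ t v) :=
  .sUnion hK (.upair hK hs ht)

theorem DefTerm.insert (hK : TransModel K) (hs : DefTerm K s) (ht : DefTerm K t) :
    DefTerm K (fun v => insert (s v) (t v)) := by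
  simp only [ZFSet.insert_eq]
  exact .union hK (.singleton hK hs) ht

theorem DefTerm.relPowerset (hK : TransModel K) (hs : DefTerm K s) :
    DefTerm K (fun v => ZFSet.sep (· ∈ K) (ZFSet.powerset (s v))) :=
  .of_mem hK.trans (P := fun v x => x ⊆ s v) (fun v => hK.relPowerset_mem (hs.1 v))
    (.subset hK.trans (.var 0) hs.tail) fun _ _ hx => by simp [hx]

theorem DefTerm.sep (hK : TransModel K) {P : (ℕ → K) → ZFSet.{u} → Prop}
    (hP : DefPred K (fun w => P (stail w) (w 0))) (hs : DefTerm K s) :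
    DefTerm K (fun v => ZFSet.sep (P v) (s v)) :=
  .of_mem hK.trans (P := fun v x => x ∈ s v ∧ P v x) (fun v => hK.sep_mem hP v (hs.1 v))
    (.and (.mem (.var 0) hs.tail) hP) fun _ _ _ => ZFSet.mem_sep

theorem DefTerm.img (hK : TransModel K) {F : (ℕ → K) → ZFSet.{u} → ZFSet.{u}}
    (hF : DefTerm K (fun w => F (stail w) (w 0))) (hs : DefTerm K s) :
    DefTerm K (fun v => img (F v) (s v)) :=
  .of_mem hK.trans (P := fun v y => ∃ x ∈ s v, F v x = y) (fun v => hK.img_mem hF v (hs.1 v))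
    (.exists_mem hK.trans hs.tail (P := fun w x => F (stail w) x = (w 0).1)
      (.eq (hF.rename fun | 0 => 0 | i + 1 => i + 2 :) (.var 1))) fun _ _ _ => mem_img

theorem DefTerm.graphOn (hK : TransModel K) {F : (ℕ → K) → ZFSet.{u} → ZFSet.{u}}
    (hF : DefTerm K (fun w => F (stail w) (w 0))) (hs : DefTerm K s) :
    DefTerm K (fun v => graphOn (F v) (s v)) :=
  .img hK (F := fun v x => ZFSet.pair x (F v x)) (.pair hK (.var 0) hF) hs

theorem DefTerm.app (hK : TransModel K) (hs : DefTerm K s) (ht : DefTerm K t) :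
    DefTerm K (fun v => app (s v) (t v)) :=
  .sUnion hK (.sep hK (P := fun v b => ZFSet.pair (t v) b ∈ s v)
    (.mem (.pair hK ht.tail (.var 0)) hs.tail) (.sUnion hK (.sUnion hK hs)))

theorem DefTerm.prod (hK : TransModel K) (hs : DefTerm K s) (ht : DefTerm K t) :
    DefTerm K (fun v => ZFSet.prod (s v) (t v)) := by
  have : (fun v => ZFSet.prod (s v) (t v)) =
      fun v => ZFSet.sUnion (KinnaWagner.img
        (fun a => KinnaWagner.img (fun b => ZFSet.pair a b) (t v)) (s v)) := by
    funext v
    ext x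
    simp only [ZFSet.mem_prod, ZFSet.mem_sUnion, mem_img]
    grind [mem_img]
  rw [this]
  exact .sUnion hK (.img hK (F := fun v a => KinnaWagner.img (fun b => ZFSet.pair a b) (t v))
    (.img hK (F := fun w b => ZFSet.pair (w 0).1 b) (.pair hK (.var 1) (.var 0)) ht.tail) hs)

end Terms

/-! ### Well-founded recursion inside a model. -/

section Recursion

/-- The elements of `D` that precede `a` in the relation coded by the set of pairs `R`. -/
def predIn (D R a : ZFSet.{u}) : ZFSet.{u} := ZFSet.sep (fun b => ZFSet.pair b a ∈ R) D

theorem mem_predIn {D R a b : ZFSet.{u}} : b ∈ predIn D R a ↔ b ∈ D ∧ ZFSet.pair b a ∈ R :=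
  ZFSet.mem_sep

/-- `g` is a partial solution on `D` of the recursion `F a = G {F b | b R a}`. -/
def IsAttempt (D R : ZFSet.{u}) (G : ZFSet.{u} → ZFSet.{u}) (g : ZFSet.{u}) : Prop :=
  ∀ p ∈ g, ∃ a ∈ D, p = ZFSet.pair a (G (img (app g) (predIn D R a))) ∧
    ∀ b ∈ predIn D R a, ZFSet.pair b (app g b) ∈ g

variable {K : Set ZFSet.{u}} {D R : ZFSet.{u}} {F G : ZFSet.{u} → ZFSet.{u}}

theorem DefTerm.predIn (hK : TransModel K) (hD : D ∈ K) (hR : R ∈ K)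
    {t : (ℕ → K) → ZFSet.{u}} (ht : DefTerm K t) : DefTerm K (fun v => predIn D R (t v)) :=
  .sep hK (P := fun v b => ZFSet.pair b (t v) ∈ R)
    (.mem (.pair hK (.var 0) ht.tail) (.const hR)) (.const hD)

theorem DefPred.isAttempt (hK : TransModel K) (hD : D ∈ K) (hR : R ∈ K)
    (hG : DefTerm K (fun v => G (v 0).1)) {t : (ℕ → K) → ZFSet.{u}} (ht : DefTerm K t) :
    DefPred K (fun v => IsAttempt D R G (t v)) := by
  refine .forall_mem hK.trans ht (P := fun v p => ∃ a ∈ D,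
    p = ZFSet.pair a (G (KinnaWagner.img (app (t v)) (predIn D R a))) ∧
    ∀ b ∈ predIn D R a, ZFSet.pair b (app (t v) b) ∈ t v) ?_
  refine .exists_mem hK.trans (.const hD) (P := fun w a =>
    (w 0).1 = ZFSet.pair a (G (KinnaWagner.img (app (t (stail w))) (predIn D R a))) ∧
    ∀ b ∈ predIn D R a, ZFSet.pair b (app (t (stail w)) b) ∈ t (stail w)) ?_
  have hpred : DefTerm K (fun w => predIn D R (w 0).1) := .predIn hK hD hR (.var 0)
  refine .and (.eq (.var 1) (.pair hK (.var 0) ?_)) ?_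
  · exact .subst (F := fun _ x => G x) hG (.img hK
      (F := fun w => app (t (stail (stail w)))) (.app hK ht.tail.tail.tail (.var 0)) hpred)
  · exact .forall_mem hK.trans hpred (P := fun w b =>
      ZFSet.pair b (app (t (stail (stail w))) b) ∈ t (stail (stail w)))
      (.mem (.pair hK (.var 0) (.app hK ht.tail.tail.tail (.var 0))) ht.tail.tail.tail)

/-- An attempt is not required to be a function; induction along `R` makes it agree with `F`, so any
two attempts agree where both are defined. -/
theorem IsAttempt.eq_of_pair_mem {g : ZFSet.{u}} (hg : IsAttempt D R G g)
    (wf : WellFounded fun b a => b ∈ D ∧ ZFSet.pair b a ∈ R)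
    (hF : ∀ a ∈ D, F a = G (img F (predIn D R a))) (a : ZFSet.{u}) :
    ∀ y, ZFSet.pair a y ∈ g → y = F a := by
  induction a using wf.induction with
  | _ a ih =>
    intro y hy
    obtain ⟨a', ha, h, hp⟩ := hg _ hy
    obtain ⟨rfl, rfl⟩ := ZFSet.pair_inj.1 h
    rw [hF a ha]
    congr 1
    exact img_congr fun b hb => ih b (mem_predIn.1 hb) _ (hp b hb)

theorem isAttempt_graphOn {E : ZFSet.{u}} (hED : E ⊆ D)
    (hE : ∀ a ∈ E, predIn D R a ⊆ E) (hF : ∀ a ∈ D, F a = G (img F (predIn D R a))) :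
    IsAttempt D R G (graphOn F E) := by
  intro p hp
  obtain ⟨a, ha, rfl⟩ := mem_img.1 hp
  refine ⟨a, hED ha, ?_, fun b hb => ?_⟩
  · rw [img_congr fun b hb => app_graphOn (hE a ha hb), ← hF a (hED ha)]
  · rw [app_graphOn (hE a ha hb)]
    exact pair_mem_graphOn.2 ⟨hE a ha hb, rfl⟩

/-- Well-founded recursion inside a transitive model of `ZF`: a function that satisfies a definable
recursion along a well-founded relation on a set of the model belongs to the model. -/
theorem graphOn_mem_of_recursion (hK : TransModel K) (hD : D ∈ K) (hR : R ∈ K)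
    (wf : WellFounded fun b a => b ∈ D ∧ ZFSet.pair b a ∈ R)
    (hG : DefTerm K (fun v => G (v 0).1))
    (hF : ∀ a ∈ D, F a = G (img F (predIn D R a))) : graphOn F D ∈ K := by
  classical
  let Q : ZFSet.{u} → Prop := fun a => ∃ g ∈ K, IsAttempt D R G g ∧ ZFSet.pair a (app g a) ∈ g
  have hval : ∀ {g a}, IsAttempt D R G g → ZFSet.pair a (app g a) ∈ g → app g a = F a :=
    fun hg h => hg.eq_of_pair_mem wf hF _ _ h
  -- `F` is not known to be definable over `K`. `H` is, because attempts in `K` determine its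
  -- values, and it agrees with `F` wherever some attempt is defined.
  let H : ZFSet.{u} → ZFSet.{u} := fun a => if Q a then F a else ∅
  have hQ : DefPred K (fun v => Q (v 0)) :=
    .exists_mem_class (P := fun v g => IsAttempt D R G g ∧ ZFSet.pair (v 0).1 (app g (v 0).1) ∈ g)
      (.and (.isAttempt hK hD hR hG (.var 0))
        (.mem (.pair hK (.var 1) (.app hK (.var 0) (.var 1))) (.var 0)))
  have happ : ∀ {f a}, f ∈ K → a ∈ K → app f a ∈ K := fun {f a} hf ha =>
    (DefTerm.app hK (.const hf) (.const ha)).1 hK.zeroAssignment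
  have hHterm : DefTerm K (fun v => H (v 0).1) := by
    refine .of_mem hK.trans (P := fun v x => ∃ g ∈ K, IsAttempt D R G g ∧
      ZFSet.pair (v 0).1 (app g (v 0).1) ∈ g ∧ x ∈ app g (v 0).1) (fun v => ?_) ?_ ?_
    · by_cases h : Q (v 0)
      · obtain ⟨g, hgK, hg, hp⟩ := id h
        simp only [H, if_pos h, ← hval hg hp]
        exact happ hgK (v 0).2
      · simp only [H, if_neg h]
        exact hK.empty_mem
    · exact .exists_mem_class (P := fun w g => IsAttempt D R G g ∧
        ZFSet.pair (w 1).1 (app g (w 1).1) ∈ g ∧ (w 0).1 ∈ app g (w 1).1)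
        (.and (.isAttempt hK hD hR hG (.var 0))
          (.and (.mem (.pair hK (.var 2) (.app hK (.var 0) (.var 2))) (.var 0))
            (.mem (.var 1) (.app hK (.var 0) (.var 2)))))
    · intro v x _
      by_cases h : Q (v 0)
      · simp only [H, if_pos h]
        obtain ⟨g, hgK, hg, hp⟩ := h
        constructor
        · intro hx
          exact ⟨g, hgK, hg, hp, by rwa [hval hg hp]⟩
        · rintro ⟨g', _, hg', hp', hx⟩
          rwa [hval hg' hp'] at hx
      · simp only [H, if_neg h, ZFSet.notMem_empty, false_iff]
        rintro ⟨g, hgK, hg, hp, _⟩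
        exact h ⟨g, hgK, hg, hp⟩
  let D' := ZFSet.sep Q D
  have hD'K : D' ∈ K :=
    hK.sep_mem (P := fun _ x => Q x) hQ hK.zeroAssignment hD
  have hD' : ∀ {a}, a ∈ D' ↔ a ∈ D ∧ Q a := ZFSet.mem_sep
  have hHF : ∀ a ∈ D', H a = F a := fun a ha => if_pos (hD'.1 ha).2
  have hgK : graphOn F D' ∈ K := by
    have : graphOn F D' = graphOn H D' := img_congr fun a ha => by rw [hHF a ha]
    rw [this]
    exact (DefTerm.graphOn hK (F := fun _ => H) hHterm (.const hD'K)).1 hK.zeroAssignment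
  have hclosed : ∀ a ∈ D', predIn D R a ⊆ D' := by
    intro a ha b hb
    obtain ⟨g, hgK, hg, hp⟩ := (hD'.1 ha).2
    obtain ⟨a', _, h, hpred⟩ := hg _ hp
    obtain ⟨rfl, -⟩ := ZFSet.pair_inj.1 h
    exact hD'.2 ⟨(mem_predIn.1 hb).1, g, hgK, hg, hpred b hb⟩
  -- If all predecessors of `a` are reached by attempts, adding the pair `(a, F a)` to the graph of
  -- `F` on `D'` gives an attempt in `K` that reaches `a`.
  have hall : ∀ a, a ∈ D → a ∈ D' := by
    intro a
    induction a using wf.induction with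
    | _ a ih =>
      intro ha
      have haK := hK.trans _ hD _ ha
      have hpred : predIn D R a ⊆ D' := fun b hb => ih b (mem_predIn.1 hb) (mem_predIn.1 hb).1
      have hFa : F a ∈ K := by
        rw [hF a ha, ← img_congr fun b hb => hHF b (hpred hb)]
        exact (DefTerm.subst (F := fun _ x => G x) hG (.img hK (F := fun _ => H) hHterm
          (.predIn hK hD hR (.const haK)))).1 hK.zeroAssignment
      have hgraph : graphOn F (insert a D') = insert (ZFSet.pair a (F a)) (graphOn F D') :=
        img_insert
      refine hD'.2 ⟨ha, graphOn F (insert a D'), ?_, isAttempt_graphOn ?_ ?_ hF, ?_⟩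
      · rw [hgraph]
        exact (DefTerm.insert hK (.pair hK (.const haK) (.const hFa)) (.const hgK)).1
          hK.zeroAssignment
      · intro x hx
        rcases ZFSet.mem_insert_iff.1 hx with rfl | hx
        exacts [ha, (hD'.1 hx).1]
      · intro x hx y hy
        rcases ZFSet.mem_insert_iff.1 hx with rfl | hx
        exacts [ZFSet.mem_insert_of_mem _ (hpred hy), ZFSet.mem_insert_of_mem _ (hclosed x hx hy)]
      · rw [app_graphOn (ZFSet.mem_insert _ _)]
        exact pair_mem_graphOn.2 ⟨ZFSet.mem_insert _ _, rfl⟩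
  have : D' = D := ZFSet.ext fun a => ⟨fun h => (hD'.1 h).1, hall a⟩
  rwa [this] at hgK

theorem apply_mem_of_graphOn_mem (hK : TransModel K) (h : graphOn F D ∈ K) {a : ZFSet.{u}}
    (ha : a ∈ D) : F a ∈ K := by
  have hp := hK.trans _ h _ (pair_mem_graphOn.2 ⟨ha, rfl⟩)
  exact hK.trans _ (hK.trans _ hp {a, F a} (by simp [ZFSet.pair])) _ (by simp)

end Recursion

/-! ### Transitive closures, ranks and the von Neumann hierarchy inside a model. -/

section TransitiveClosure

variable {K : Set ZFSet.{u}}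

/-- `t` is the least transitive set of `K` that has `x` as a member. -/
def IsLeastTransitive (K : Set ZFSet.{u}) (x t : ZFSet.{u}) : Prop :=
  (x ∈ t ∧ ∀ y ∈ t, y ⊆ t) ∧ ∀ s ∈ K, x ∈ s → (∀ y ∈ s, y ⊆ s) → t ⊆ s

theorem DefPred.isLeastTransitive (hK : TransModel K) {s t : (ℕ → K) → ZFSet.{u}}
    (hs : DefTerm K s) (ht : DefTerm K t) :
    DefPred K (fun v => IsLeastTransitive K (s v) (t v)) := by
  have htr : ∀ {r : (ℕ → K) → ZFSet.{u}}, DefTerm K r → DefPred K (fun v => ∀ y ∈ r v, y ⊆ r v) :=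
    fun {r} hr => .forall_mem hK.trans hr (P := fun v y => y ⊆ r v)
      (.subset hK.trans (.var 0) hr.tail)
  exact .and (.and (.mem hs ht) (htr ht)) (.forall_mem_class
    (P := fun v r => s v ∈ r → (∀ y ∈ r, y ⊆ r) → t v ⊆ r)
    (.imp (.mem hs.tail (.var 0)) (.imp (htr (.var 0)) (.subset hK.trans ht.tail (.var 0)))))

/-- By ∈-induction: the union of the closures of the members of `x`, together with `x` itself.
Leastness makes the closures unique, hence definable, so that Replacement can collect them. -/
theorem exists_isLeastTransitive (hK : TransModel K) (x : ZFSet.{u}) :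
    x ∈ K → ∃ t ∈ K, IsLeastTransitive K x t := by
  classical
  induction x using ZFSet.inductionOn with
  | _ x ih =>
    intro hx
    let T : ZFSet.{u} → ZFSet.{u} := fun y =>
      if h : ∃ t ∈ K, IsLeastTransitive K y t then h.choose else ∅
    have huniq : ∀ {y t t'}, t ∈ K → t' ∈ K → IsLeastTransitive K y t →
        IsLeastTransitive K y t' → t ⊆ t' := fun _ ht' h h' => h.2 _ ht' h'.1.1 h'.1.2
    have hT : DefTerm K (fun v => T (v 0).1) := by
      refine .of_mem hK.trans (P := fun v z => ∃ t ∈ K, IsLeastTransitive K (v 0) t ∧ z ∈ t)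
        (fun v => ?_) ?_ ?_
      · simp only [T]
        split_ifs with h
        exacts [h.choose_spec.1, hK.empty_mem]
      · exact .exists_mem_class (P := fun w t => IsLeastTransitive K (w 1) t ∧ (w 0).1 ∈ t)
          (.and (.isLeastTransitive hK (.var 2) (.var 0)) (.mem (.var 1) (.var 0)))
      · intro v z _
        simp only [T]
        split_ifs with h
        · constructor
          · intro hz
            exact ⟨_, h.choose_spec.1, h.choose_spec.2, hz⟩
          · rintro ⟨t, htK, ht, hz⟩
            exact huniq htK h.choose_spec.1 ht h.choose_spec.2 hz
        · simp only [ZFSet.notMem_empty, false_iff]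
          rintro ⟨t, htK, ht, _⟩
          exact h ⟨t, htK, ht⟩
    have hTx : ∀ y ∈ x, T y ∈ K ∧ IsLeastTransitive K y (T y) := by
      intro y hy
      have h := ih y hy (hK.trans _ hx _ hy)
      simp only [T, dif_pos h]
      exact h.choose_spec
    refine ⟨insert x (ZFSet.sUnion (img T x)), (DefTerm.insert hK (.const hx) (.sUnion hK
      (.img hK (F := fun _ => T) hT (.const hx)))).1 hK.zeroAssignment,
      ⟨ZFSet.mem_insert _ _, ?_⟩, ?_⟩
    · intro y hy z hz
      refine ZFSet.mem_insert_of_mem _ (ZFSet.mem_sUnion.2 ?_)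
      rcases ZFSet.mem_insert_iff.1 hy with rfl | hy
      · exact ⟨T z, mem_img.2 ⟨z, hz, rfl⟩, (hTx z hz).2.1.1⟩
      · obtain ⟨_, ht, hyt⟩ := ZFSet.mem_sUnion.1 hy
        obtain ⟨w, hw, rfl⟩ := mem_img.1 ht
        exact ⟨T w, mem_img.2 ⟨w, hw, rfl⟩, (hTx w hw).2.1.2 _ hyt hz⟩
    · intro s hs hxs hst y hy
      rcases ZFSet.mem_insert_iff.1 hy with rfl | hy
      · exact hxs
      · obtain ⟨_, ht, hyt⟩ := ZFSet.mem_sUnion.1 hy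
        obtain ⟨w, hw, rfl⟩ := mem_img.1 ht
        exact (hTx w hw).2.2 s hs (hst x hxs hw) hst hyt

theorem exists_transitive_mem (hK : TransModel K) {x : ZFSet.{u}} (hx : x ∈ K) :
    ∃ t ∈ K, x ∈ t ∧ t.IsTransitive :=
  let ⟨t, ht, h⟩ := exists_isLeastTransitive hK x hx
  ⟨t, ht, h.1.1, fun _ hy => h.1.2 _ hy⟩

/-- Recursion along membership inside a transitive model of `ZF`. -/
theorem apply_mem_of_mem_recursion (hK : TransModel K) {F G : ZFSet.{u} → ZFSet.{u}}
    (hG : DefTerm K (fun v => G (v 0).1)) (hF : ∀ a, F a = G (img F a)) {x : ZFSet.{u}}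
    (hx : x ∈ K) : F x ∈ K := by
  obtain ⟨D, hD, hxD, hDt⟩ := exists_transitive_mem hK hx
  let R := ZFSet.sep (fun p => ∃ a ∈ D, ∃ b ∈ a, p = ZFSet.pair b a) (ZFSet.prod D D)
  have hR : R ∈ K := hK.sep_mem (P := fun _ p => ∃ a ∈ D, ∃ b ∈ a, p = ZFSet.pair b a)
    (.exists_mem hK.trans (.const hD) (P := fun w a => ∃ b ∈ a, (w 0).1 = ZFSet.pair b a)
      (.exists_mem hK.trans (.var 0) (P := fun w b => (w 1).1 = ZFSet.pair b (w 0).1)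
        (.eq (.var 2) (.pair hK (.var 0) (.var 1)))))
    hK.zeroAssignment ((DefTerm.prod hK (.const hD) (.const hD)).1 hK.zeroAssignment)
  have hRmem : ∀ {a b}, ZFSet.pair b a ∈ R ↔ a ∈ D ∧ b ∈ a := by
    intro a b
    simp only [R, ZFSet.mem_sep, ZFSet.pair_mem_prod, ZFSet.pair_inj]
    constructor
    · rintro ⟨_, a', ha', b', hb', rfl, rfl⟩
      exact ⟨ha', hb'⟩
    · rintro ⟨ha, hb⟩
      exact ⟨⟨hDt a ha hb, ha⟩, a, ha, b, hb, rfl, rfl⟩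
  refine apply_mem_of_graphOn_mem hK (graphOn_mem_of_recursion hK hD hR ?_ hG fun a ha => ?_) hxD
  · exact Subrelation.wf (fun h => (hRmem.1 h.2).2) ZFSet.mem_wf
  · rw [hF a]
    congr 2
    ext b
    rw [mem_predIn, hRmem]
    exact ⟨fun hb => ⟨hDt a ha hb, ha, hb⟩, fun h => h.2.2⟩

/-- The rank of `x` is the supremum of the successors of the ranks of its members, a definable
∈-recursion. -/
theorem toZFSet_rank_mem (hK : TransModel K) {x : ZFSet.{u}} (hx : x ∈ K) :
    x.rank.toZFSet ∈ K := by
  refine apply_mem_of_mem_recursion hK (F := fun x => x.rank.toZFSet)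
    (G := fun s => ZFSet.sUnion (img (fun y => insert y y) s))
    (.sUnion hK (.img hK (F := fun _ y => insert y y) (.insert hK (.var 0) (.var 0)) (.var 0)))
    (fun a => ?_) hx
  ext y
  simp only [ZFSet.mem_sUnion, mem_img, Ordinal.mem_toZFSet_iff]
  constructor
  · rintro ⟨o, ho, rfl⟩
    obtain ⟨z, hz, hoz⟩ := ZFSet.lt_rank_iff.1 ho
    refine ⟨_, ⟨_, ⟨z, hz, rfl⟩, rfl⟩, ?_⟩
    rw [← Ordinal.toZFSet_add_one, Ordinal.toZFSet_mem_toZFSet_iff]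
    exact Order.lt_add_one_iff.2 hoz
  · rintro ⟨_, ⟨_, ⟨z, hz, rfl⟩, rfl⟩, hy⟩
    rw [← Ordinal.toZFSet_add_one, Ordinal.mem_toZFSet_iff] at hy
    obtain ⟨o, ho, rfl⟩ := hy
    exact ⟨o, (Order.lt_add_one_iff.1 ho).trans_lt (ZFSet.rank_lt_of_mem hz), rfl⟩

open scoped ZFSet in
/-- The sets of `K` whose rank is below the rank of a set of `K` form a set of `K`. -/
theorem sep_vonNeumann_mem (hK : TransModel K) {x : ZFSet.{u}} (hx : x ∈ K) :
    ZFSet.sep (· ∈ K) (V_ x.rank) ∈ K := by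
  -- The recursion is `V_(rank a) ∩ K = ⋃_{z ∈ a} P(V_(rank z) ∩ K) ∩ K`.
  refine apply_mem_of_mem_recursion hK (F := fun x => ZFSet.sep (· ∈ K) (V_ x.rank))
    (G := fun s => ZFSet.sUnion (img (fun y => ZFSet.sep (· ∈ K) (ZFSet.powerset y)) s))
    (.sUnion hK (.img hK (F := fun _ y => ZFSet.sep (· ∈ K) (ZFSet.powerset y))
      (.relPowerset hK (.var 0)) (.var 0)))
    (fun a => ?_) hx
  ext y
  simp only [ZFSet.mem_sUnion, mem_img, ZFSet.mem_sep, ZFSet.mem_vonNeumann, ZFSet.lt_rank_iff]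
  constructor
  · rintro ⟨⟨z, hz, hyz⟩, hyK⟩
    refine ⟨_, ⟨_, ⟨z, hz, rfl⟩, rfl⟩, ZFSet.mem_sep.2 ⟨ZFSet.mem_powerset.2 fun w hw => ?_, hyK⟩⟩
    exact ZFSet.mem_sep.2 ⟨ZFSet.mem_vonNeumann.2 ((ZFSet.rank_lt_of_mem hw).trans_le hyz),
      hK.trans _ hyK _ hw⟩
  · rintro ⟨_, ⟨_, ⟨z, hz, rfl⟩, rfl⟩, hy⟩
    obtain ⟨hy, hyK⟩ := ZFSet.mem_sep.1 hy
    refine ⟨⟨z, hz, ZFSet.subset_vonNeumann.1 fun w hw => ?_⟩, hyK⟩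
    exact (ZFSet.mem_sep.1 (ZFSet.mem_powerset.1 hy hw)).1

end TransitiveClosure

/-! ### Projections of ordered pairs. -/

section PairProjections

/-- The first component of an ordered pair. -/
def pairFst (p : ZFSet.{u}) : ZFSet.{u} :=
  ZFSet.sUnion (ZFSet.sep (fun a => ∃ b ∈ ZFSet.sUnion p, p = ZFSet.pair a b) (ZFSet.sUnion p))

/-- The second component of an ordered pair. -/
def pairSnd (p : ZFSet.{u}) : ZFSet.{u} :=
  ZFSet.sUnion (ZFSet.sep (fun b => ∃ a ∈ ZFSet.sUnion p, p = ZFSet.pair a b) (ZFSet.sUnion p))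

theorem mem_sUnion_pair {a b x : ZFSet.{u}} :
    x ∈ ZFSet.sUnion (ZFSet.pair a b) ↔ x = a ∨ x = b := by
  simp [ZFSet.pair]

@[simp] theorem pairFst_pair (a b : ZFSet.{u}) : pairFst (ZFSet.pair a b) = a := by
  have : ZFSet.sep (fun x => ∃ y ∈ ZFSet.sUnion (ZFSet.pair a b), ZFSet.pair a b = ZFSet.pair x y)
      (ZFSet.sUnion (ZFSet.pair a b)) = {a} := by
    ext x
    simp only [ZFSet.mem_sep, mem_sUnion_pair, ZFSet.pair_inj, ZFSet.mem_singleton]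
    exact ⟨fun ⟨_, _, _, h, _⟩ => h.symm, fun h => ⟨.inl h, b, .inr rfl, h.symm, rfl⟩⟩
  rw [pairFst, this, ZFSet.sUnion_singleton]

@[simp] theorem pairSnd_pair (a b : ZFSet.{u}) : pairSnd (ZFSet.pair a b) = b := by
  have : ZFSet.sep (fun x => ∃ y ∈ ZFSet.sUnion (ZFSet.pair a b), ZFSet.pair a b = ZFSet.pair y x)
      (ZFSet.sUnion (ZFSet.pair a b)) = {b} := by
    ext x
    simp only [ZFSet.mem_sep, mem_sUnion_pair, ZFSet.pair_inj, ZFSet.mem_singleton]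
    exact ⟨fun ⟨_, _, _, _, h⟩ => h.symm, fun h => ⟨.inr h, a, .inl rfl, rfl, h.symm⟩⟩
  rw [pairSnd, this, ZFSet.sUnion_singleton]

variable {K : Set ZFSet.{u}} {t : (ℕ → K) → ZFSet.{u}}

theorem DefTerm.pairFst (hK : TransModel K) (ht : DefTerm K t) :
    DefTerm K (fun v => pairFst (t v)) :=
  .sUnion hK (.sep hK (P := fun v a => ∃ b ∈ ZFSet.sUnion (t v), t v = ZFSet.pair a b)
    (.exists_mem hK.trans (.sUnion hK ht.tail) (P := fun w b => t (stail w) = ZFSet.pair (w 0).1 b)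
      (.eq ht.tail.tail (.pair hK (.var 1) (.var 0)))) (.sUnion hK ht))

theorem DefTerm.pairSnd (hK : TransModel K) (ht : DefTerm K t) :
    DefTerm K (fun v => pairSnd (t v)) :=
  .sUnion hK (.sep hK (P := fun v b => ∃ a ∈ ZFSet.sUnion (t v), t v = ZFSet.pair a b)
    (.exists_mem hK.trans (.sUnion hK ht.tail) (P := fun w a => t (stail w) = ZFSet.pair a (w 0).1)
      (.eq ht.tail.tail (.pair hK (.var 0) (.var 1)))) (.sUnion hK ht))

end PairProjections

/-! ### Coding pairs of ordinals by ordinals. -/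

section LexCode

variable {K : Set ZFSet.{u}} {o : Ordinal.{u}}

/-- The position of a pair of ordinals below `o` in the lexicographic order. -/
noncomputable def lexCode (o : Ordinal.{u}) (p : ZFSet.{u}) : ZFSet.{u} :=
  (o * (pairFst p).rank + (pairSnd p).rank).toZFSet

theorem lexCode_pair (a b : Ordinal.{u}) :
    lexCode o (ZFSet.pair a.toZFSet b.toZFSet) = (o * a + b).toZFSet := by
  simp [lexCode]

theorem mem_prod_toZFSet {p : ZFSet.{u}} : p ∈ ZFSet.prod o.toZFSet o.toZFSet ↔
    ∃ a < o, ∃ b < o, p = ZFSet.pair a.toZFSet b.toZFSet := by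
  simp only [ZFSet.mem_prod, Ordinal.mem_toZFSet_iff]
  constructor
  · rintro ⟨_, ⟨a, ha, rfl⟩, _, ⟨b, hb, rfl⟩, rfl⟩
    exact ⟨a, ha, b, hb, rfl⟩
  · rintro ⟨a, ha, b, hb, rfl⟩
    exact ⟨_, ⟨a, ha, rfl⟩, _, ⟨b, hb, rfl⟩, rfl⟩

theorem mul_add_lt_mul_add {a b c d : Ordinal.{u}} (hb : b < o)
    (h : a < c ∨ a = c ∧ b < d) : o * a + b < o * c + d := by
  rcases h with h | ⟨rfl, h⟩
  · calc o * a + b < o * a + o := by gcongr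
      _ = o * (a + 1) := by rw [mul_add, mul_one]
      _ ≤ o * c := by gcongr; exact Order.add_one_le_of_lt h
      _ ≤ o * c + d := le_self_add
  · gcongr

/-- Division with remainder by `o`: the ordinals below the code of a pair are exactly the codes of
its lexicographic predecessors. -/
theorem lt_mul_add_iff {c d e : Ordinal.{u}} (hc : c < o) (hd : d < o) :
    e < o * c + d ↔ ∃ a < o, ∃ b < o, (a < c ∨ a = c ∧ b < d) ∧ e = o * a + b := by
  constructor
  · intro he
    have ho : o ≠ 0 := (bot_le.trans_lt hc).ne'
    have hac : e / o ≤ c := by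
      rw [← Order.lt_add_one_iff, ← Ordinal.lt_mul_iff_div_lt ho, mul_add, mul_one]
      exact he.trans (by gcongr)
    have hdm := Ordinal.div_add_mod e o
    refine ⟨e / o, hac.trans_lt hc, e % o, Ordinal.mod_lt e ho, ?_, hdm.symm⟩
    rcases hac.lt_or_eq with h | h
    · exact .inl h
    · refine .inr ⟨h, ?_⟩
      rw [← hdm, h] at he
      exact lt_of_add_lt_add_left he
  · rintro ⟨a, _, b, hb, h, rfl⟩
    exact mul_add_lt_mul_add hb h

/-- `lexCode o` is the collapse of the lexicographic order, so `K` obtains it by recursion with `G =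
id`, without developing ordinal arithmetic in `K`. -/
theorem graphOn_lexCode_mem (hK : TransModel K) (ho : o.toZFSet ∈ K) :
    graphOn (lexCode o) (ZFSet.prod o.toZFSet o.toZFSet) ∈ K := by
  let D := ZFSet.prod o.toZFSet o.toZFSet
  have hD : D ∈ K := (DefTerm.prod hK (.const ho) (.const ho)).1 hK.zeroAssignment
  let L : ZFSet.{u} → Prop := fun q =>
    pairFst (pairFst q) ∈ pairFst (pairSnd q) ∨
      pairFst (pairFst q) = pairFst (pairSnd q) ∧ pairSnd (pairFst q) ∈ pairSnd (pairSnd q)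
  let R := ZFSet.sep L (ZFSet.prod D D)
  have hR : R ∈ K := hK.sep_mem (P := fun _ => L)
    (.or (.mem (.pairFst hK (.pairFst hK (.var 0))) (.pairFst hK (.pairSnd hK (.var 0))))
      (.and (.eq (.pairFst hK (.pairFst hK (.var 0))) (.pairFst hK (.pairSnd hK (.var 0))))
        (.mem (.pairSnd hK (.pairFst hK (.var 0))) (.pairSnd hK (.pairSnd hK (.var 0))))))
    hK.zeroAssignment ((DefTerm.prod hK (.const hD) (.const hD)).1 hK.zeroAssignment)
  have hRmem : ∀ {a b c d : Ordinal.{u}}, a < o → b < o → c < o → d < o →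
      (ZFSet.pair (ZFSet.pair a.toZFSet b.toZFSet) (ZFSet.pair c.toZFSet d.toZFSet) ∈ R ↔
        a < c ∨ a = c ∧ b < d) := by
    intro a b c d ha hb hc hd
    simp only [R, L, ZFSet.mem_sep, pairFst_pair, pairSnd_pair, Ordinal.toZFSet_mem_toZFSet_iff,
      Ordinal.toZFSet_injective.eq_iff, ZFSet.pair_mem_prod, D, ha, hb, hc, hd, and_self, true_and]
  refine graphOn_mem_of_recursion hK hD hR ?_ (G := id) (.var 0) ?_
  · refine Subrelation.wf (r := InvImage (· ∈ ·) (lexCode o)) ?_ (InvImage.wf _ ZFSet.mem_wf)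
    rintro p q ⟨hp, hpq⟩
    have hq := (ZFSet.pair_mem_prod.1 (ZFSet.mem_sep.1 hpq).1).2
    obtain ⟨a, ha, b, hb, rfl⟩ := mem_prod_toZFSet.1 hp
    obtain ⟨c, hc, d, hd, rfl⟩ := mem_prod_toZFSet.1 hq
    simp only [InvImage, lexCode_pair, Ordinal.toZFSet_mem_toZFSet_iff]
    exact mul_add_lt_mul_add hb ((hRmem ha hb hc hd).1 hpq)
  · intro q hq
    obtain ⟨c, hc, d, hd, rfl⟩ := mem_prod_toZFSet.1 hq
    ext y
    simp only [lexCode_pair, Ordinal.mem_toZFSet_iff, id, mem_img, mem_predIn]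
    constructor
    · rintro ⟨e, he, rfl⟩
      obtain ⟨a, ha, b, hb, h, rfl⟩ := (lt_mul_add_iff hc hd).1 he
      exact ⟨_, ⟨mem_prod_toZFSet.2 ⟨a, ha, b, hb, rfl⟩, (hRmem ha hb hc hd).2 h⟩,
        lexCode_pair a b⟩
    · rintro ⟨p, ⟨hp, hpq⟩, rfl⟩
      obtain ⟨a, ha, b, hb, rfl⟩ := mem_prod_toZFSet.1 hp
      exact ⟨_, mul_add_lt_mul_add hb ((hRmem ha hb hc hd).1 hpq), (lexCode_pair a b).symm⟩

theorem lexCode_pair_inj {a b c d : Ordinal.{u}} (hb : b < o) (hd : d < o)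
    (h : lexCode o (ZFSet.pair a.toZFSet b.toZFSet) =
      lexCode o (ZFSet.pair c.toZFSet d.toZFSet)) : a = c ∧ b = d := by
  rw [lexCode_pair, lexCode_pair, Ordinal.toZFSet_injective.eq_iff] at h
  have hac : a = c := by
    by_contra hne
    rcases lt_or_gt_of_ne hne with hlt | hlt
    · exact (mul_add_lt_mul_add hb (.inl hlt)).ne h
    · exact (mul_add_lt_mul_add hd (.inl hlt)).ne' h
  subst hac
  exact ⟨rfl, by simpa using h⟩

end LexCode

/-! ### Monotonicity and transitivity of iterated power classes. -/

section IteratedPower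

variable {K A B : Set ZFSet.{u}}

theorem relIterPower_mono (h : A ⊆ B) (β : Ordinal.{u}) :
    relIterPower K A β ⊆ relIterPower K B β := by
  induction β using Ordinal.limitRecOn with
  | zero => simpa only [relIterPower_zero]
  | add_one β ih =>
    simp only [relIterPower_add_one]
    exact fun x hx => ⟨hx.1, fun y hy => ih (hx.2 y hy)⟩
  | limit β hβ ih =>
    simp only [relIterPower_limit _ _ _ hβ]
    rintro x ⟨γ, hγ, hx⟩
    exact ⟨γ, hγ, ih γ hγ hx⟩

theorem relIterPower_subset (h : A ⊆ K) (β : Ordinal.{u}) : relIterPower K A β ⊆ K := by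
  induction β using Ordinal.limitRecOn with
  | zero => simpa only [relIterPower_zero]
  | add_one β ih =>
    simp only [relIterPower_add_one]
    exact fun x hx => hx.1
  | limit β hβ ih =>
    simp only [relIterPower_limit _ _ _ hβ]
    rintro x ⟨γ, hγ, hx⟩
    exact ih γ hγ hx

theorem relIterPower_transitive (h : A ⊆ K) (hA : TransitiveClass A) (β : Ordinal.{u}) :
    TransitiveClass (relIterPower K A β) := by
  induction β using Ordinal.limitRecOn with
  | zero => simpa only [relIterPower_zero]
  | add_one β ih =>
    simp only [relIterPower_add_one]
    exact fun x hx y hy => ⟨relIterPower_subset h β (hx.2 y hy), ih y (hx.2 y hy)⟩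
  | limit β hβ ih =>
    simp only [relIterPower_limit _ _ _ hβ]
    rintro x ⟨γ, hγ, hx⟩ y hy
    exact ⟨γ, hγ, ih γ hγ x hx y hy⟩

theorem relIterPower_le (h : A ⊆ K) (hA : TransitiveClass A) {β γ : Ordinal.{u}} (hβγ : β ≤ γ) :
    relIterPower K A β ⊆ relIterPower K A γ := by
  induction γ using Ordinal.limitRecOn with
  | zero => rw [nonpos_iff_eq_zero.1 hβγ]
  | add_one γ ih =>
    rcases hβγ.eq_or_lt with rfl | hlt
    · rfl
    · refine (ih (Order.lt_add_one_iff.1 hlt)).trans fun x hx => ?_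
      rw [relIterPower_add_one]
      exact ⟨relIterPower_subset h γ hx, relIterPower_transitive h hA γ x hx⟩
  | limit γ hγ ih =>
    rcases hβγ.eq_or_lt with rfl | hlt
    · rfl
    · intro x hx
      rw [relIterPower_limit _ _ _ hγ]
      exact ⟨β, hlt, hx⟩

theorem ordinalsOf_subset : ordinalsOf K ⊆ K := fun _ h => h.1

theorem ordinalsOf_transitive (hK : TransitiveClass K) : TransitiveClass (ordinalsOf K) :=
  fun x hx y hy => ⟨hK x hx.1 y hy, hx.2.mem hy⟩

theorem pair_mem_relIterPower_limit (hK : TransModel K) (h : A ⊆ K) (hA : TransitiveClass A)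
    {β : Ordinal.{u}} (hβ : Order.IsSuccLimit β) {a b : ZFSet.{u}}
    (ha : a ∈ relIterPower K A β) (hb : b ∈ relIterPower K A β) :
    ZFSet.pair a b ∈ relIterPower K A β := by
  rw [relIterPower_limit _ _ _ hβ] at ha hb ⊢
  obtain ⟨γ, hγ, ha⟩ := ha
  obtain ⟨δ, hδ, hb⟩ := hb
  have ha' := relIterPower_le h hA (le_max_left γ δ) ha
  have hb' := relIterPower_le h hA (le_max_right γ δ) hb
  have haK := relIterPower_subset h _ ha
  have hbK := relIterPower_subset h _ hb
  -- A Kuratowski pair lies two power steps above its components.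
  refine ⟨max γ δ + 1 + 1, hβ.add_one_lt (hβ.add_one_lt (max_lt hγ hδ)), ?_⟩
  simp only [relIterPower_add_one]
  have haa : ({a} : ZFSet.{u}) ∈ K := by simpa using hK.upair_mem haK haK
  have hab := hK.upair_mem haK hbK
  refine ⟨hK.upair_mem haa hab, fun y hy => ?_⟩
  simp only [ZFSet.pair, ZFSet.mem_insert_iff, ZFSet.mem_singleton] at hy
  rcases hy with rfl | rfl
  · exact ⟨haa, fun z hz => by rwa [ZFSet.mem_singleton.1 hz]⟩
  · refine ⟨hab, fun z hz => ?_⟩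
    rcases ZFSet.mem_pair.1 hz with rfl | rfl
    exacts [ha', hb']

end IteratedPower

/-! ### Coding pairs within a level of the iterated power class. -/

section PairingCode

variable {M N : Set ZFSet.{u}}

/-- `h` codes the pairs of elements of `D` by elements of `C`. -/
def IsPairingCode (D : ZFSet.{u}) (C : Set ZFSet.{u}) (h : ZFSet.{u}) : Prop :=
  (∀ a ∈ D, ∀ b ∈ D, app h (ZFSet.pair a b) ∈ C) ∧
  ∀ a ∈ D, ∀ b ∈ D, ∀ a' ∈ D, ∀ b' ∈ D,
    app h (ZFSet.pair a b) = app h (ZFSet.pair a' b') → a = a' ∧ b = b'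

/-- All elements of `D` are ordinals below `o = rank D`, an ordinal of both models, so the same
`lexCode o` serves in both. -/
theorem exists_pairingCode_ordinals (hM : TransModel M) (hN : TransModel N) {D : ZFSet.{u}}
    (hDM : D ∈ M) (hDN : D ∈ N) (hD : ∀ x ∈ D, x ∈ ordinalsOf M) :
    ∃ h ∈ M, h ∈ N ∧ IsPairingCode D (ordinalsOf M) h := by
  have hgM := graphOn_lexCode_mem hM (toZFSet_rank_mem hM hDM)
  have hmem : ∀ x ∈ D, ∃ a < D.rank, a.toZFSet = x := fun x hx =>
    ⟨x.rank, ZFSet.rank_lt_of_mem hx, (hD x hx).2.toZFSet_rank_eq⟩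
  refine ⟨_, hgM, graphOn_lexCode_mem hN (toZFSet_rank_mem hN hDN), fun a ha b hb => ?_,
    fun a ha b hb a' ha' b' hb' h => ?_⟩
  · obtain ⟨a, la, rfl⟩ := hmem a ha
    obtain ⟨b, lb, rfl⟩ := hmem b hb
    have hp := mem_prod_toZFSet.2 ⟨a, la, b, lb, rfl⟩
    rw [app_graphOn hp]
    exact ⟨apply_mem_of_graphOn_mem hM hgM hp, ZFSet.isOrdinal_toZFSet _⟩
  · obtain ⟨a, la, rfl⟩ := hmem a ha
    obtain ⟨b, lb, rfl⟩ := hmem b hb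
    obtain ⟨a', la', rfl⟩ := hmem a' ha'
    obtain ⟨b', lb', rfl⟩ := hmem b' hb'
    rw [app_graphOn (mem_prod_toZFSet.2 ⟨a, la, b, lb, rfl⟩),
      app_graphOn (mem_prod_toZFSet.2 ⟨a', la', b', lb', rfl⟩)] at h
    obtain ⟨rfl, rfl⟩ := lexCode_pair_inj lb lb' h
    exact ⟨rfl, rfl⟩

/-- The disjoint union of the components of a pair, with elements coded by `h`. -/
noncomputable def sumCode (h p : ZFSet.{u}) : ZFSet.{u} :=
  img (fun u => app h (ZFSet.pair u ∅)) (pairFst p) ∪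
    img (fun u => app h (ZFSet.pair u {∅})) (pairSnd p)

theorem DefTerm.sumCode {K : Set ZFSet.{u}} (hK : TransModel K) {s t : (ℕ → K) → ZFSet.{u}}
    (hs : DefTerm K s) (ht : DefTerm K t) : DefTerm K (fun v => sumCode (s v) (t v)) :=
  have h0 : DefTerm K (fun _ => ∅) := .const hK.empty_mem
  .union hK
    (.img hK (F := fun v u => KinnaWagner.app (s v) (ZFSet.pair u ∅))
      (.app hK hs.tail (.pair hK (.var 0) h0)) (.pairFst hK ht))
    (.img hK (F := fun v u => KinnaWagner.app (s v) (ZFSet.pair u {∅}))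
      (.app hK hs.tail (.pair hK (.var 0) (.singleton hK h0))) (.pairSnd hK ht))

/-- One level up, `(a, b)` is coded by a disjoint union: the codes of `(u, ∅)` for `u ∈ a` and of
`(u, {∅})` for `u ∈ b`. Injectivity of the lower code recovers `a` and `b`. -/
theorem exists_pairingCode_powerset (hM : TransModel M) (hN : TransModel N) {C : Set ZFSet.{u}}
    (h0 : ∅ ∈ C) (h1 : {∅} ∈ C)
    (ih : ∀ D ∈ M, D ∈ N → (∀ x ∈ D, x ∈ C) → ∃ h ∈ M, h ∈ N ∧ IsPairingCode D C h)
    {D : ZFSet.{u}} (hDM : D ∈ M) (hDN : D ∈ N) (hD : ∀ x ∈ D, x ∈ relPowerset M C) :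
    ∃ h ∈ M, h ∈ N ∧ IsPairingCode D (relPowerset M C) h := by
  -- The lower code must handle the members of elements of `D` and the two tags.
  let E : ZFSet.{u} := insert ∅ (insert {∅} (ZFSet.sUnion D))
  have hE : ∀ {K : Set ZFSet.{u}}, TransModel K → D ∈ K → E ∈ K := fun hK hDK =>
    (DefTerm.insert hK (.const hK.empty_mem) (.insert hK (.singleton hK (.const hK.empty_mem))
      (.sUnion hK (.const hDK)))).1 hK.zeroAssignment
  have e0 : ∅ ∈ E := ZFSet.mem_insert _ _
  have e1 : {∅} ∈ E := ZFSet.mem_insert_of_mem _ (ZFSet.mem_insert _ _)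
  have eD : ∀ {x u}, x ∈ D → u ∈ x → u ∈ E := fun hx hu =>
    ZFSet.mem_insert_of_mem _ (ZFSet.mem_insert_of_mem _ (ZFSet.mem_sUnion.2 ⟨_, hx, hu⟩))
  have h01 : (∅ : ZFSet.{u}) ≠ {∅} := fun h =>
    ZFSet.notMem_empty ∅ ((ZFSet.ext_iff.1 h ∅).2 (ZFSet.mem_singleton.2 rfl))
  obtain ⟨h, hhM, hhN, hC, hinj⟩ := ih E (hE hM hDM) (hE hN hDN) (by
    intro x hx
    simp only [E, ZFSet.mem_insert_iff, ZFSet.mem_sUnion] at hx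
    rcases hx with rfl | rfl | ⟨y, hy, hxy⟩
    exacts [h0, h1, (hD y hy).2 x hxy])
  have hg : ∀ {K : Set ZFSet.{u}}, TransModel K → D ∈ K → h ∈ K →
      graphOn (sumCode h) (ZFSet.prod D D) ∈ K := fun hK hDK hhK =>
    (DefTerm.graphOn hK (F := fun _ => sumCode h) (.sumCode hK (.const hhK) (.var 0))
      (.prod hK (.const hDK) (.const hDK))).1 hK.zeroAssignment
  have hval : ∀ {a b}, a ∈ D → b ∈ D → app (graphOn (sumCode h) (ZFSet.prod D D))
      (ZFSet.pair a b) = sumCode h (ZFSet.pair a b) :=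
    fun ha hb => app_graphOn (ZFSet.pair_mem_prod.2 ⟨ha, hb⟩)
  have hmem : ∀ {a b x}, x ∈ sumCode h (ZFSet.pair a b) ↔
      (∃ u ∈ a, app h (ZFSet.pair u ∅) = x) ∨ ∃ u ∈ b, app h (ZFSet.pair u {∅}) = x := by
    simp [sumCode]
  have hfst : ∀ {a b u}, a ∈ D → b ∈ D → u ∈ E →
      (app h (ZFSet.pair u ∅) ∈ sumCode h (ZFSet.pair a b) ↔ u ∈ a) := by
    intro a b u ha hb hu
    rw [hmem]
    constructor
    · rintro (⟨w, hw, e⟩ | ⟨w, hw, e⟩)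
      · rwa [← (hinj _ (eD ha hw) _ e0 _ hu _ e0 e).1]
      · exact absurd (hinj _ (eD hb hw) _ e1 _ hu _ e0 e).2.symm h01
    · exact fun h => .inl ⟨u, h, rfl⟩
  have hsnd : ∀ {a b u}, a ∈ D → b ∈ D → u ∈ E →
      (app h (ZFSet.pair u {∅}) ∈ sumCode h (ZFSet.pair a b) ↔ u ∈ b) := by
    intro a b u ha hb hu
    rw [hmem]
    constructor
    · rintro (⟨w, hw, e⟩ | ⟨w, hw, e⟩)
      · exact absurd (hinj _ (eD ha hw) _ e0 _ hu _ e1 e).2 h01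
      · rwa [← (hinj _ (eD hb hw) _ e1 _ hu _ e1 e).1]
    · exact fun h => .inr ⟨u, h, rfl⟩
  refine ⟨_, hg hM hDM hhM, hg hN hDN hhN, fun a ha b hb => ?_, fun a ha b hb a' ha' b' hb' e => ?_⟩
  · rw [hval ha hb]
    refine ⟨apply_mem_of_graphOn_mem hM (hg hM hDM hhM) (ZFSet.pair_mem_prod.2 ⟨ha, hb⟩),
      fun y hy => ?_⟩
    rcases hmem.1 hy with ⟨u, hu, rfl⟩ | ⟨u, hu, rfl⟩
    exacts [hC _ (eD ha hu) _ e0, hC _ (eD hb hu) _ e1]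
  · rw [hval ha hb, hval ha' hb'] at e
    constructor
    · ext u
      constructor <;> intro hu
      · rwa [← hfst ha' hb' (eD ha hu), ← e, hfst ha hb (eD ha hu)]
      · rwa [← hfst ha hb (eD ha' hu), e, hfst ha' hb' (eD ha' hu)]
    · ext u
      constructor <;> intro hu
      · rwa [← hsnd ha' hb' (eD hb hu), ← e, hsnd ha hb (eD hb hu)]
      · rwa [← hsnd ha hb (eD hb' hu), e, hsnd ha' hb' (eD hb' hu)]

/-- Pairs of elements of a set of sets in `P^β(Ord)^M` can be coded by elements of `P^β(Ord)^M`,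
by a function that belongs to every transitive model that contains the set. -/
theorem exists_pairingCode (hM : TransModel M) (hN : TransModel N) (β : Ordinal.{u}) :
    ∀ D ∈ M, D ∈ N → (∀ x ∈ D, x ∈ relIterPower M (ordinalsOf M) β) →
      ∃ h ∈ M, h ∈ N ∧ IsPairingCode D (relIterPower M (ordinalsOf M) β) h := by
  induction β using Ordinal.limitRecOn with
  | zero =>
    simp only [relIterPower_zero]
    exact fun D hDM hDN hD => exists_pairingCode_ordinals hM hN hDM hDN hD
  | add_one β ih =>
    simp only [relIterPower_add_one]
    have hsub := relIterPower_le ordinalsOf_subset (ordinalsOf_transitive hM.trans)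
      (zero_le (a := β))
    rw [relIterPower_zero] at hsub
    have h1 : ({∅} : ZFSet.{u}) ∈ M := by simpa using hM.upair_mem hM.empty_mem hM.empty_mem
    refine fun D hDM hDN hD => exists_pairingCode_powerset hM hN
      (hsub ⟨hM.empty_mem, ZFSet.isOrdinal_empty⟩) (hsub ⟨h1, ?_⟩) ih hDM hDN hD
    simpa using ZFSet.isOrdinal_succ ZFSet.isOrdinal_empty
  | limit β hβ _ =>
    intro D hDM hDN hD
    -- A limit level is closed under ordered pairs, so each pair codes itself.
    have hg : ∀ {K : Set ZFSet.{u}}, TransModel K → D ∈ K →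
        graphOn id (ZFSet.prod D D) ∈ K := fun hK hDK =>
      (DefTerm.graphOn hK (F := fun _ => id) (.var 0)
        (.prod hK (.const hDK) (.const hDK))).1 hK.zeroAssignment
    have hval : ∀ {a b}, a ∈ D → b ∈ D → app (graphOn id (ZFSet.prod D D))
        (ZFSet.pair a b) = ZFSet.pair a b :=
      fun ha hb => app_graphOn (ZFSet.pair_mem_prod.2 ⟨ha, hb⟩)
    refine ⟨_, hg hM hDM, hg hN hDN, fun a ha b hb => ?_, fun a ha b hb a' ha' b' hb' e => ?_⟩
    · rw [hval ha hb]
      exact pair_mem_relIterPower_limit hM ordinalsOf_subset (ordinalsOf_transitive hM.trans) hβ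
        (hD a ha) (hD b hb)
    · rw [hval ha hb, hval ha' hb'] at e
      exact ZFSet.pair_inj.1 e

end PairingCode

/-! ### The two inclusions. -/

section MainTheorem

variable {M N : Set ZFSet.{u}} {α : Ordinal.{u}}

/-- The domain of the partial surjection is a set of `M` included in `P^α(η)^M ⊆ P^α(Ord)^M`, hence
an element of the next level; this removes `η`. -/
theorem ModelsKWPStar.exists_covering (h : ModelsKWPStar M α) (hM : TransModel M) {x : ZFSet.{u}}
    (hx : x ∈ M) : ∃ f ∈ M, ∃ D ∈ relIterPower M (ordinalsOf M) (α + 1),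
      (∀ a ∈ D, app f a ∈ x) ∧ ∀ b ∈ x, ∃ a ∈ D, app f a = b := by
  obtain ⟨η, hη, f, hf, h1, h2, h3⟩ := h x hx
  have happ : ∀ {a b}, ZFSet.pair a b ∈ f → app f a = b := fun {a b} hp =>
    app_eq hp fun c hc => h2 a c b hc hp
  have hval : ∀ {a b}, ZFSet.pair a b ∈ f →
      a ∈ relIterPower M (ordinalsOf M) α ∧ b ∈ x := by
    intro a b hp
    obtain ⟨a', ha', b', hb', e⟩ := h1 _ hp
    obtain ⟨rfl, rfl⟩ := ZFSet.pair_inj.1 e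
    refine ⟨relIterPower_mono (fun y hy => ?_) α ha', hb'⟩
    exact ⟨hM.trans _ hη y hy, (ZFSet.isOrdinal_toZFSet η).mem hy⟩
  refine ⟨f, hf, ZFSet.sep (fun a => ∃ b ∈ x, ZFSet.pair a b ∈ f)
    (ZFSet.sUnion (ZFSet.sUnion f)), ?_, fun a ha => ?_, fun b hb => ?_⟩
  · rw [relIterPower_add_one]
    refine ⟨hM.sep_mem (P := fun _ a => ∃ b ∈ x, ZFSet.pair a b ∈ f)
      (.exists_mem hM.trans (.const hx) (P := fun w b => ZFSet.pair (w 0).1 b ∈ f)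
        (.mem (.pair hM (.var 1) (.var 0)) (.const hf)))
      hM.zeroAssignment (hM.sUnion_mem (hM.sUnion_mem hf)), fun a ha => ?_⟩
    obtain ⟨_, b, _, hp⟩ := ZFSet.mem_sep.1 ha
    exact (hval hp).1
  · obtain ⟨_, b, hb, hp⟩ := ZFSet.mem_sep.1 ha
    rwa [happ hp]
  · obtain ⟨a, hp⟩ := h3 b hb
    exact ⟨a, ZFSet.mem_sep.2 ⟨(mem_sUnion_sUnion_of_pair hp).1, b, hb, hp⟩, happ hp⟩

theorem subset_of_relIterPower_subset (hM : TransModel M) (hN : TransModel N)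
    (hP : relIterPower M (ordinalsOf M) (α + 1) ⊆ N) (hKWP : ModelsKWPStar M α) : M ⊆ N := by
  intro x hx
  obtain ⟨t, ht, hxt, htt⟩ := exists_transitive_mem hM hx
  obtain ⟨f, hf, D, hD, hfD, hsurj⟩ := hKWP.exists_covering hM ht
  have hDN := hP hD
  rw [relIterPower_add_one] at hD
  obtain ⟨hDM, hDα⟩ := hD
  obtain ⟨h, hhM, hhN, hC, hinj⟩ := exists_pairingCode hM hN α D hDM hDN hDα
  -- Membership on `t`, pulled back along `f` to `D`.
  let E := ZFSet.sep (fun p => app f (pairFst p) ∈ app f (pairSnd p)) (ZFSet.prod D D)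
  have hEM : E ∈ M := hM.sep_mem (P := fun _ p => app f (pairFst p) ∈ app f (pairSnd p))
    (.mem (.app hM (.const hf) (.pairFst hM (.var 0)))
      (.app hM (.const hf) (.pairSnd hM (.var 0))))
    hM.zeroAssignment ((DefTerm.prod hM (.const hDM) (.const hDM)).1 hM.zeroAssignment)
  have hE : ∀ {a b}, ZFSet.pair a b ∈ E ↔ (a ∈ D ∧ b ∈ D) ∧ app f a ∈ app f b := by
    intro a b
    simp only [E, ZFSet.mem_sep, ZFSet.pair_mem_prod, pairFst_pair, pairSnd_pair]
  have hcodeN : img (app h) E ∈ N := by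
    refine hP ?_
    rw [relIterPower_add_one]
    refine ⟨hM.img_mem (F := fun _ => app h) (.app hM (.const hhM) (.var 0)) hM.zeroAssignment hEM,
      fun y hy => ?_⟩
    obtain ⟨p, hp, rfl⟩ := mem_img.1 hy
    obtain ⟨a, ha, b, hb, rfl⟩ := ZFSet.mem_prod.1 (ZFSet.mem_sep.1 hp).1
    exact hC a ha b hb
  -- `N` contains both the code `h` and the coded set, and decodes `E` by injectivity of `h` on
  -- pairs.
  have hEN : E ∈ N := by
    have : E = ZFSet.sep (fun p => app h p ∈ img (app h) E) (ZFSet.prod D D) := by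
      refine ZFSet.ext fun p => Iff.trans ⟨?_, ?_⟩ ZFSet.mem_sep.symm
      · exact fun hp => ⟨(ZFSet.mem_sep.1 hp).1, mem_img.2 ⟨p, hp, rfl⟩⟩
      · rintro ⟨hp, hpc⟩
        obtain ⟨q, hq, e⟩ := mem_img.1 hpc
        obtain ⟨a, ha, b, hb, rfl⟩ := ZFSet.mem_prod.1 hp
        obtain ⟨c, hc, d, hd, rfl⟩ := ZFSet.mem_prod.1 (ZFSet.mem_sep.1 hq).1
        obtain ⟨rfl, rfl⟩ := hinj c hc d hd a ha b hb e
        exact hq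
    rw [this]
    exact hN.sep_mem (P := fun _ p => app h p ∈ img (app h) E)
      (.mem (.app hN (.const hhN) (.var 0)) (.const hcodeN))
      hN.zeroAssignment ((DefTerm.prod hN (.const hDN) (.const hDN)).1 hN.zeroAssignment)
  -- Surjectivity of `f` onto the transitive `t` gives `f a = {f b | b E a}`. Only well-foundedness
  -- of `E` is needed, so `f` may fail to be injective.
  have hgraph : graphOn (app f) D ∈ N := by
    refine graphOn_mem_of_recursion hN hDN hEN ?_ (G := id) (.var 0) fun a ha => ?_
    · exact Subrelation.wf (r := InvImage (· ∈ ·) (app f)) (fun h => (hE.1 h.2).2)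
        (InvImage.wf _ ZFSet.mem_wf)
    · ext y
      simp only [id, mem_img, mem_predIn, hE]
      constructor
      · intro hy
        obtain ⟨b, hb, rfl⟩ := hsurj y (htt _ (hfD a ha) hy)
        exact ⟨b, ⟨hb, ⟨hb, ha⟩, hy⟩, rfl⟩
      · rintro ⟨b, ⟨_, _, hy⟩, rfl⟩
        exact hy
  obtain ⟨a, ha, rfl⟩ := hsurj x hxt
  exact apply_mem_of_graphOn_mem hN hgraph ha

/-- Singletons of elements of a level lie in the next level, so the next level determines this one.
-/
theorem relIterPower_subset_of_add_one_eq {A B : Set ZFSet.{u}} (hM : TransModel M) (hA : A ⊆ M)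
    (h : relIterPower M A (α + 1) = relIterPower N B (α + 1)) :
    relIterPower M A α ⊆ relIterPower N B α := by
  intro a ha
  have haM := relIterPower_subset hA α ha
  have hs : ({a} : ZFSet.{u}) ∈ relIterPower M A (α + 1) := by
    rw [relIterPower_add_one]
    refine ⟨by simpa using hM.upair_mem haM haM, fun y hy => ?_⟩
    rwa [ZFSet.mem_singleton.1 hy]
  rw [h, relIterPower_add_one] at hs
  exact hs.2 a (ZFSet.mem_singleton.2 rfl)

/-- A transitive model `M` of `ZF` and `KWP*_α` is determined by `P^(α+1)(Ord^M)^M` among the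
transitive models of `ZF`. -/
theorem eq_of_relIterPower_eq (hM : TransModel M) (hN : TransModel N)
    (hP : relIterPower M (ordinalsOf M) (α + 1) = relIterPower N (ordinalsOf N) (α + 1))
    (hKWP : ModelsKWPStar M α) : M = N := by
  have hMN : M ⊆ N := subset_of_relIterPower_subset hM hN
    (hP ▸ relIterPower_subset ordinalsOf_subset _) hKWP
  have hord : ordinalsOf N ⊆ M := by
    have := relIterPower_le ordinalsOf_subset (ordinalsOf_transitive hN.trans)
      (zero_le (a := α + 1))
    rw [relIterPower_zero, ← hP] at this
    exact this.trans (relIterPower_subset ordinalsOf_subset _)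
  refine hMN.antisymm fun y => ?_
  induction y using ZFSet.inductionOn with
  | _ y ih =>
    intro hy
    -- Since `y ∈ M` is not yet known, the ordinal `rank y` replaces it: it has the same rank and is
    -- in `M` because every ordinal of `N` is.
    have hv := sep_vonNeumann_mem hM (hord ⟨toZFSet_rank_mem hN hy, ZFSet.isOrdinal_toZFSet _⟩)
    rw [Ordinal.rank_toZFSet] at hv
    obtain ⟨f, hf, D, hD, hfD, hsurj⟩ := hKWP.exists_covering hM hv
    rw [relIterPower_add_one] at hD
    let S := ZFSet.sep (fun a => app f a ∈ y) D
    have hSN : S ∈ N := hN.sep_mem (P := fun _ a => app f a ∈ y)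
      (.mem (.app hN (.const (hMN hf)) (.var 0)) (.const hy)) hN.zeroAssignment (hMN hD.1)
    -- `S` is a set of `N` included in `P^α(Ord)^N`, so it lies in the level `α + 1` that the two
    -- models share.
    have hSM : S ∈ M := by
      have : S ∈ relIterPower N (ordinalsOf N) (α + 1) := by
        rw [relIterPower_add_one]
        exact ⟨hSN, fun a ha => relIterPower_subset_of_add_one_eq hM ordinalsOf_subset hP
          (hD.2 a (ZFSet.mem_sep.1 ha).1)⟩
      rw [← hP] at this
      exact relIterPower_subset ordinalsOf_subset _ this
    have hyS : y = img (app f) S := by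
      ext z
      rw [mem_img]
      constructor
      · intro hz
        obtain ⟨a, ha, rfl⟩ := hsurj z (ZFSet.mem_sep.2
          ⟨ZFSet.mem_vonNeumann.2 (ZFSet.rank_lt_of_mem hz), ih z hz (hN.trans _ hy _ hz)⟩)
        exact ⟨a, ZFSet.mem_sep.2 ⟨ha, hz⟩, rfl⟩
      · rintro ⟨a, ha, rfl⟩
        exact (ZFSet.mem_sep.1 ha).2
    rw [hyS]
    exact hM.img_mem (F := fun _ => app f) (.app hM (.const hf) (.var 0)) hM.zeroAssignment hSM

end MainTheorem

end KinnaWagner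

theorem mainTheorem9 (M N : Set ZFSet.{u})
    (hMtrans : KinnaWagner.TransitiveClass M) (hNtrans : KinnaWagner.TransitiveClass N)
    (hM : KinnaWagner.ModelsZF M) (hN : KinnaWagner.ModelsZF N)
    (α : Ordinal.{u}) (hα : α.toZFSet ∈ M)
    (hP : KinnaWagner.relIterPower M (KinnaWagner.ordinalsOf M) (α + 1) =
      KinnaWagner.relIterPower N (KinnaWagner.ordinalsOf N) (α + 1))
    (hKWP : KinnaWagner.ModelsKWPStar M α) :
    M = N :=
  KinnaWagner.eq_of_relIterPower_eq ⟨hMtrans, hM⟩ ⟨hNtrans, hN⟩ hP hKWP
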